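/- Let $V=(V,Y,\mathbf 1,\omega)$ be a simple vertex operator algebra over $\mathbb C$, with finite-dimensional homogeneous subspaces $V_n$ ($n\in\mathbb Z$, $V_n=0$ for $n\ll 0$), and let $G\le \mathrm{Aut}(V)$ be a compact Lie group of automorphisms of $V$ acting continuously on $V$ (i.e. continuously on each $V_n$). Let $(W_\lambda)_{\lambda\in\Lambda}$ be a family of simple $G$-submodules of $V$, each contained in some $V_k$, pairwise non-isomorphic, and such that every simple $G$-submodule of $V$ is isomorphic to some $W_\lambda$. Put $V_\lambda=\mathrm{Hom}_G(W_\lambda,V)$, and identify $w\otimes f\in W_\lambda\otimes V_\lambda$ with $f(w)\in V$. Let $U$ be a sub vertex operator algebra of $V$ with $V^G\subset U\subset V$. Then there are unique subspaces $R_\lambda\subset W_\lambda$ such that $$U=\bigoplus_{\lambda\in\Lambda}R_\lambda\otimes V_\lambda .$$ Moreover, with $W=\bigoplus_{\lambda}W_\lambda$ (a $G$-submodule of $V$) and $R=\bigoplus_\lambda R_\lambda\subset W$, every $G$-module homomorphism $\pi: W\otimes_{\mathbb C}W\to W$ satisfies $\pi(R\otimes R)\subset R$. -/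

import Mathlib

open scoped TensorProduct DirectSum ContDiff Manifold

noncomputable section

/-- A vertex operator algebra structure on the complex vector space `V`.  The state-field map `Y`
takes values in Mathlib's vertex operators (linear maps `V → V((z))`), so that `u_n v = 0` for `n`
large is built in; `VertexOperator.ncoeff (Y u) n` is the mode `u_n` in
`Y(u,z) = ∑ u_n z^(-n-1)`. -/
structure VOA (V : Type*) [AddCommGroup V] [Module ℂ V] where
  /-- the state-field correspondence -/
  Y : V →ₗ[ℂ] VertexOperator ℂ V
  /-- the vacuum vector -/
  vac : V
  /-- the conformal vector -/
  conf : V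
  /-- the central charge -/
  charge : ℂ
  /-- the homogeneous subspaces -/
  gr : ℤ → Submodule ℂ V
  gr_internal : DirectSum.IsInternal gr
  gr_finite : ∀ n, FiniteDimensional ℂ (gr n)
  gr_bounded : ∃ N : ℤ, ∀ n < N, gr n = ⊥
  /-- `Y(1,z) = id` -/
  vac_mode : ∀ (n : ℤ) (v : V), VertexOperator.ncoeff (Y vac) n v = if n = -1 then v else 0
  /-- `Y(v,z)1` has no negative powers of `z` ... -/
  creation : ∀ (v : V) (n : ℤ), 0 ≤ n → VertexOperator.ncoeff (Y v) n vac = 0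
  /-- ... and constant term `v` -/
  creation_neg_one : ∀ v : V, VertexOperator.ncoeff (Y v) (-1) vac = v
  /-- the Jacobi identity, in components; all sums have finite support -/
  jacobi : ∀ (u v w : V) (p q r : ℤ),
    ∑ᶠ i : ℕ, Ring.choose p i •
        VertexOperator.ncoeff (Y (VertexOperator.ncoeff (Y u) (r + i) v)) (p + q - i) w =
      ∑ᶠ i : ℕ, ((-1 : ℤ) ^ i * Ring.choose r i) •
        (VertexOperator.ncoeff (Y u) (p + r - i) (VertexOperator.ncoeff (Y v) (q + i) w) -
          (Int.negOnePow r : ℤ) •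
            VertexOperator.ncoeff (Y v) (q + r - i) (VertexOperator.ncoeff (Y u) (p + i) w))
  /-- the Virasoro relations for `L(n) = ω_{n+1}` -/
  virasoro : ∀ (m n : ℤ) (v : V),
    VertexOperator.ncoeff (Y conf) (m + 1) (VertexOperator.ncoeff (Y conf) (n + 1) v) -
      VertexOperator.ncoeff (Y conf) (n + 1) (VertexOperator.ncoeff (Y conf) (m + 1) v) =
    ((m : ℂ) - n) • VertexOperator.ncoeff (Y conf) (m + n + 1) v +
      (if m + n = 0 then (((m : ℂ) ^ 3 - m) / 12 * charge) • v else 0)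
  /-- `L(0)` acts on `gr n` as `n` -/
  weight : ∀ (n : ℤ), ∀ v ∈ gr n, VertexOperator.ncoeff (Y conf) 1 v = (n : ℂ) • v
  /-- `Y(L(-1)v,z) = d/dz Y(v,z)` -/
  translation : ∀ (u v : V) (n : ℤ),
    VertexOperator.ncoeff (Y (VertexOperator.ncoeff (Y conf) 0 u)) n v =
      (-(n : ℂ)) • VertexOperator.ncoeff (Y u) (n - 1) v

namespace VOA

variable {V : Type*} [AddCommGroup V] [Module ℂ V] (A : VOA V)

/-- The mode `u_n ∈ End V`. -/
abbrev mode (u : V) (n : ℤ) : Module.End ℂ V := VertexOperator.ncoeff (A.Y u) n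

/-- `V` is simple: it is nonzero and irreducible as a module over itself. -/
def IsSimple : Prop :=
  Nontrivial V ∧ ∀ I : Submodule ℂ V, (∀ (u : V) (n : ℤ), ∀ x ∈ I, A.mode u n x ∈ I) →
    I = ⊥ ∨ I = ⊤

/-- `U` is a sub VOA (with the same vacuum and conformal vector).  It is automatically graded,
since it is stable under `L(0) = ω_1`. -/
structure IsSubVOA (U : Submodule ℂ V) : Prop where
  vac_mem : A.vac ∈ U
  conf_mem : A.conf ∈ U
  mode_mem : ∀ u ∈ U, ∀ (n : ℤ), ∀ v ∈ U, A.mode u n v ∈ U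

/-- The group `Aut(V)` of automorphisms of the vertex operator algebra. -/
def aut : Subgroup (V ≃ₗ[ℂ] V) where
  carrier := {g | g A.vac = A.vac ∧ g A.conf = A.conf ∧
    ∀ (u : V) (n : ℤ) (v : V), g (A.mode u n v) = A.mode (g u) n (g v)}
  mul_mem' := by
    rintro a b ⟨ha, ha', ha''⟩ ⟨hb, hb', hb''⟩
    exact ⟨by simp [ha, hb], by simp [ha', hb'], fun u n v => by simp [hb'', ha'']⟩
  one_mem' := ⟨rfl, rfl, fun _ _ _ => rfl⟩
  inv_mem' := by
    rintro a ⟨ha, ha', ha''⟩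
    refine ⟨?_, ?_, fun u n v => ?_⟩
    · exact (LinearEquiv.symm_apply_eq a).2 ha.symm
    · exact (LinearEquiv.symm_apply_eq a).2 ha'.symm
    · refine (LinearEquiv.symm_apply_eq a).2 ?_
      rw [ha'']
      have h : ∀ x, a (a⁻¹ x) = x := fun x => LinearEquiv.apply_symm_apply a x
      rw [h, h]

variable {A} {G : Type*} [Group G]

/-- The representation on `V` of a group acting by automorphisms of the VOA. -/
def rep (act : G →* A.aut) : Representation ℂ G V :=
  (LinearEquiv.automorphismGroup.toLinearMapMonoidHom).comp (A.aut.subtype.comp act)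

/-- The action is continuous: all matrix coefficients are continuous.  As `G` preserves the
finite-dimensional spaces `gr n`, this says that the representation on each `gr n` is
continuous. -/
def ActsContinuously [TopologicalSpace G] (act : G →* A.aut) : Prop :=
  ∀ (v : V) (f : Module.Dual ℂ V), Continuous fun g : G => f (rep act g v)

variable (act : G →* A.aut) {Λ : Type*} (W : Λ → Subrepresentation (rep act))

/-- `(W l)` is a system of representatives, inside `V`, of the simple `G`-modules occurring
in `V`, each one contained in a homogeneous subspace of `V`. -/
structure IsSystemOfSimples : Prop where
  irreducible : ∀ l, (W l).toRepresentation.IsIrreducible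
  homogeneous : ∀ l, ∃ k : ℤ, (W l).toSubmodule ≤ A.gr k
  inequivalent : ∀ l m, l ≠ m →
    IsEmpty ((W l).toRepresentation.Equiv (W m).toRepresentation)
  complete : ∀ X : Subrepresentation (rep act), X.toRepresentation.IsIrreducible →
    ∃ l, Nonempty (X.toRepresentation.Equiv (W l).toRepresentation)

/-- The multiplicity space `V_l = Hom_G(W_l, V)`. -/
abbrev MultSpace (l : Λ) : Type _ := (W l).toRepresentation.IntertwiningMap (rep act)

/-- The evaluation map `⨁ R_l ⊗ V_l → V`, `w ⊗ f ↦ f w`, for subspaces `R_l ⊆ W_l`. -/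
def evalSum (R : ∀ l, Submodule ℂ (W l).toSubmodule) :
    (⨁ l, R l ⊗[ℂ] MultSpace act W l) →ₗ[ℂ] V :=
  open Classical in
  DirectSum.toModule ℂ Λ V fun l => TensorProduct.lift <|
    LinearMap.mk₂ ℂ (fun (w : R l) (f : MultSpace act W l) => f (w : (W l).toSubmodule))
      (fun _ _ _ => by simp) (fun _ _ _ => by simp) (fun _ _ _ => rfl) (fun _ _ _ => rfl)

/-- `U = ⨁ R_l ⊗ V_l`: the evaluation map identifies `⨁ R_l ⊗ V_l` with `U`. -/
def IsDecomposition (U : Submodule ℂ V) (R : ∀ l, Submodule ℂ (W l).toSubmodule) : Prop :=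
  Function.Injective (evalSum act W R) ∧ LinearMap.range (evalSum act W R) = U

/-- The `G`-submodule `W = ⨁ W_l` of `V`. -/
def total : Subrepresentation (rep act) where
  toSubmodule := ⨆ l, (W l).toSubmodule
  apply_mem_toSubmodule g := by
    have h : (⨆ l, (W l).toSubmodule) ≤ (⨆ l, (W l).toSubmodule).comap (rep act g) :=
      iSup_le fun l x hx => Submodule.mem_iSup_of_mem l ((W l).apply_mem_toSubmodule g hx)
    exact fun v hv => h hv

/-- The subspace `R = ⨁ R_l` of `W = ⨁ W_l`. -/
def totalSub (R : ∀ l, Submodule ℂ (W l).toSubmodule) :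
    Submodule ℂ (total act W).toSubmodule :=
  ⨆ l, (R l).map (Submodule.inclusion (le_iSup (fun l => (W l).toSubmodule) l))

end VOA

end

/-!
Let `Z` be finite-dimensional and let `β i : Z → V` be jointly injective. Weak associativity shows
that the maps `∑ (a_{i,n})_n ∘ β i`, the `a_{i,n}` being states, are stable under composition with
modes; by simplicity of `V`, Schur's lemma and Jacobson density they exhaust `Hom(Z, V)`. If `Z` is
a `G`-module and the `β i` and `φ : Z → V` are equivariant, averaging the coefficients of such an
expression for `φ` over `G` makes them `G`-invariant, hence elements of `U`. So `φ` maps to `U`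
every vector that all the `β i` map to `U`.

For a submodule `Z` of `V` and its inclusion as the only `β`, this says that `U` is stable under all
`G`-maps between submodules of `V`, and this stability forces `U = ⨁ (U ∩ W_λ) ⊗ V_λ`. For
`Z = X ⊗ Y` with `X` and `Y` in `V`, take `β n : x ⊗ y ↦ x_n y`; these are jointly injective because
`V` is simple, so a `G`-map on `X ⊗ Y` sends `(U ∩ X) ⊗ (U ∩ Y)` into `U`.
-/

open scoped MonoidAlgebra

/-! ### Continuous representations of compact groups -/

section WeakIntegral
open MeasureTheory

variable {𝕜 K V : Type*} [RCLike 𝕜] [TopologicalSpace K] [CompactSpace K] [AddCommGroup V]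
  [Module 𝕜 V] {φ : K → V}

theorem finiteDimensional_span_range_of_continuous_dual
    (hφ : ∀ f : Module.Dual 𝕜 V, Continuous fun k => f (φ k)) :
    FiniteDimensional 𝕜 (Submodule.span 𝕜 (Set.range φ)) := by
  by_contra hfin
  obtain ⟨b, hbφ, hspan, hb⟩ := exists_linearIndependent 𝕜 (Set.range φ)
  have hinf : b.Infinite := fun h => hfin (hspan ▸ FiniteDimensional.span_of_finite 𝕜 h)
  let e : ℕ ↪ b := hinf.natEmbedding
  choose k hk using fun n => hbφ (e n).2
  obtain ⟨f, hf⟩ : ∃ f : Module.Dual 𝕜 V, ∀ n : ℕ, f (φ (k n)) = n := by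
    have he : LinearIndependent 𝕜 fun n => (e n : V) := hb.comp _ e.injective
    obtain ⟨r, hr⟩ := LinearMap.exists_leftInverse_of_injective _ (LinearMap.ker_eq_bot.2 he)
    refine ⟨Finsupp.linearCombination 𝕜 (fun n : ℕ => (n : 𝕜)) ∘ₗ r, fun n => ?_⟩
    have hrn := LinearMap.congr_fun hr (Finsupp.single n 1)
    simp only [LinearMap.comp_apply, Finsupp.linearCombination_single, one_smul,
      LinearMap.id_apply] at hrn
    rw [hk, LinearMap.comp_apply, hrn, Finsupp.linearCombination_single, one_smul]
  obtain ⟨C, hC⟩ := isCompact_univ.exists_bound_of_continuousOn (hφ f).continuousOn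
  obtain ⟨n, hn⟩ := exists_nat_gt C
  have hCn := hC (k n) (Set.mem_univ _)
  rw [hf, RCLike.norm_natCast] at hCn
  exact hn.not_ge hCn

theorem exists_forall_dual_eq_integral [MeasurableSpace K] [BorelSpace K] (μ : Measure K)
    [IsFiniteMeasure μ] (hφ : ∀ f : Module.Dual 𝕜 V, Continuous fun k => f (φ k)) :
    ∃ w : V, ∀ f : Module.Dual 𝕜 V, f w = ∫ k, f (φ k) ∂μ := by
  have := finiteDimensional_span_range_of_continuous_dual hφ
  let b := Module.finBasis 𝕜 (Submodule.span 𝕜 (Set.range φ))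
  choose c hc using fun i => LinearMap.exists_extend (b.coord i)
  have hsum : ∀ k, φ k = ∑ i, c i (φ k) • (b i : V) := fun k => by
    have hk := congrArg Subtype.val (b.sum_repr ⟨φ k, Submodule.subset_span ⟨k, rfl⟩⟩)
    simp only [AddSubmonoidClass.coe_finsetSum, Submodule.coe_smul, ← Module.Basis.coord_apply,
      ← hc] at hk
    exact hk.symm
  have hint : ∀ f : Module.Dual 𝕜 V, Integrable (fun k => f (φ k)) μ := fun f =>
    (hφ f).integrable_of_hasCompactSupport (HasCompactSupport.of_compactSpace _)
  refine ⟨∑ i, (∫ k, c i (φ k) ∂μ) • (b i : V), fun f => ?_⟩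
  calc f (∑ i, (∫ k, c i (φ k) ∂μ) • (b i : V))
      = ∑ i, ∫ k, c i (φ k) * f (b i) ∂μ := by
        simp only [map_sum, map_smul, smul_eq_mul, integral_mul_const]
    _ = ∫ k, ∑ i, c i (φ k) * f (b i) ∂μ :=
        (integral_finsetSum _ fun i _ => (hint (c i)).mul_const _).symm
    _ = ∫ k, f (φ k) ∂μ := by
        refine integral_congr_ae (.of_forall fun k => ?_)
        simp only [← smul_eq_mul, ← map_smul, ← map_sum, ← hsum]

end WeakIntegral

/-- The inclusion of a subrepresentation, as an intertwining map. -/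
def subrepresentationSubtype {R G V : Type*} [CommSemiring R] [Monoid G] [AddCommMonoid V]
    [Module R V] {ρ : Representation R G V} (X : Subrepresentation ρ) :
    X.toRepresentation.IntertwiningMap ρ where
  toLinearMap := X.toSubmodule.subtype
  isIntertwining' _ := rfl

section WeaklyContinuous

variable {𝕜 G V Z : Type*} [RCLike 𝕜] [Group G] [TopologicalSpace G] [AddCommGroup V] [Module 𝕜 V]
  [AddCommGroup Z] [Module 𝕜 Z] {ρ : Representation 𝕜 G V} {τ : Representation 𝕜 G Z}

/-- A representation of a topological group on a vector space without topology is weakly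
continuous if all its matrix coefficients are continuous. -/
def IsWeaklyContinuous (ρ : Representation 𝕜 G V) : Prop :=
  ∀ (v : V) (f : Module.Dual 𝕜 V), Continuous fun g => f (ρ g v)

namespace IsWeaklyContinuous

theorem toRepresentation (hρ : IsWeaklyContinuous ρ) (X : Subrepresentation ρ) :
    IsWeaklyContinuous X.toRepresentation := fun x f => by
  obtain ⟨F, rfl⟩ := LinearMap.exists_extend f
  exact hρ x F

theorem finsupp (hρ : IsWeaklyContinuous ρ) (ι : Type*) :
    IsWeaklyContinuous (ρ.finsupp ι) := fun p f => by
  induction p using Finsupp.induction_linear with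
  | zero => simpa only [map_zero] using continuous_const
  | add p q hp hq =>
    simp only [map_add]
    exact hp.add hq
  | single i v =>
    simp only [Representation.finsupp_single]
    exact hρ v (f ∘ₗ Finsupp.lsingle i)

theorem linHom [IsTopologicalGroup G] [FiniteDimensional 𝕜 Z] (hτ : IsWeaklyContinuous τ)
    (hρ : IsWeaklyContinuous ρ) : IsWeaklyContinuous (τ.linHom ρ) := fun h F => by
  let b := Module.finBasis 𝕜 Z
  let E : Fin (Module.finrank 𝕜 Z) → V →ₗ[𝕜] Z →ₗ[𝕜] V := fun i => LinearMap.smulRightₗ (b.coord i)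
  have hcoeff : ∀ g, F (τ.linHom ρ g h) =
      ∑ i, ∑ j, b.coord j (τ g⁻¹ (b i)) * F (E i (ρ g (h (b j)))) := fun g => by
    simp only [← smul_eq_mul, ← map_smul, ← map_sum]
    congr 1
    refine b.ext fun k => ?_
    simp [E, LinearMap.sum_apply, Finsupp.single_apply, ← map_smul, ← map_sum, b.sum_repr,
      Representation.linHom_apply]
  simp only [hcoeff]
  exact continuous_finsetSum _ fun i _ => continuous_finsetSum _ fun j _ =>
    ((hτ _ _).comp continuous_inv).mul (hρ _ (F ∘ₗ E i))

variable [CompactSpace G]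

theorem exists_finiteDimensional_subrepresentation (hρ : IsWeaklyContinuous ρ) (v : V) :
    ∃ X : Subrepresentation ρ, FiniteDimensional 𝕜 X.toSubmodule ∧ v ∈ X.toSubmodule := by
  refine ⟨⟨Submodule.span 𝕜 (Set.range fun g => ρ g v), fun g x hx => ?_⟩,
    finiteDimensional_span_range_of_continuous_dual (hρ v),
    Submodule.subset_span ⟨1, by simp only [map_one, Module.End.one_apply]⟩⟩
  suffices h : Submodule.span 𝕜 (Set.range fun g => ρ g v) ≤
      (Submodule.span 𝕜 (Set.range fun g => ρ g v)).comap (ρ g) from h hx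
  rw [Submodule.span_le]
  rintro _ ⟨h, rfl⟩
  exact Submodule.subset_span ⟨g * h, by simp only [map_mul, Module.End.mul_apply]⟩

variable [IsTopologicalGroup G]

open MeasureTheory in
theorem exists_mem_invariants_eq (hρ : IsWeaklyContinuous ρ) (Θ : ρ.IntertwiningMap τ) {v : V}
    (hv : Θ v ∈ τ.invariants) : ∃ w ∈ ρ.invariants, Θ w = Θ v := by
  borelize G
  let μ : Measure G := Measure.haarMeasure ⊤
  have : IsProbabilityMeasure μ := ⟨Measure.haarMeasure_self⟩
  obtain ⟨w, hw⟩ := exists_forall_dual_eq_integral μ (hρ v)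
  refine ⟨w, fun g => Module.eval_apply_injective 𝕜 (LinearMap.ext fun f => ?_),
    Module.eval_apply_injective 𝕜 (LinearMap.ext fun f => ?_)⟩
  · calc f (ρ g w) = ∫ h, f (ρ (g * h) v) ∂μ := by
          simp only [map_mul, Module.End.mul_apply]
          exact hw (f ∘ₗ ρ g)
      _ = f w := by rw [integral_mul_left_eq_self (fun h => f (ρ h v)) g, hw]
  · calc f (Θ w) = ∫ g, f (Θ (ρ g v)) ∂μ := hw (f ∘ₗ Θ.toLinearMap)
      _ = f (Θ v) := by
          simp only [Θ.isIntertwining, hv _, integral_const, probReal_univ, one_smul]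

theorem isSemisimpleRepresentation [FiniteDimensional 𝕜 V] (hρ : IsWeaklyContinuous ρ) :
    ρ.IsSemisimpleRepresentation where
  exists_isCompl Y := by
    let σ := Y.toRepresentation
    let res : (ρ.linHom σ).IntertwiningMap (σ.linHom σ) :=
      ⟨LinearMap.lcomp 𝕜 _ Y.toSubmodule.subtype, fun _ => rfl⟩
    obtain ⟨p, hp⟩ := Y.toSubmodule.subtype.exists_leftInverse_of_injective
      Y.toSubmodule.ker_subtype
    have hinv : res p ∈ (σ.linHom σ).invariants := fun g =>
      (congrArg (σ.linHom σ g) hp).trans <| LinearMap.ext (σ.self_inv_apply g) |>.trans hp.symm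
    obtain ⟨P, hP, hPp⟩ := (hρ.linHom (hρ.toRepresentation Y)).exists_mem_invariants_eq res hinv
    have hPρ := (Representation.mem_linHom_invariants_iff_isIntertwining P).1 hP
    have hcompl := LinearMap.isCompl_of_proj fun y => LinearMap.congr_fun (hPp.trans hp) y
    refine ⟨⟨LinearMap.ker P, fun g x hx => ?_⟩, IsCompl.of_eq ?_ ?_⟩
    · rw [LinearMap.mem_ker] at hx ⊢
      rw [hPρ.isIntertwining, hx, map_zero]
    · exact Subrepresentation.toSubmodule_injective hcompl.inf_eq_bot
    · exact Subrepresentation.toSubmodule_injective hcompl.sup_eq_top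

end IsWeaklyContinuous
end WeaklyContinuous

theorem finsupp_representation_apply {𝕜 G V ι : Type*} [CommSemiring 𝕜] [Monoid G]
    [AddCommMonoid V] [Module 𝕜 V] (ρ : Representation 𝕜 G V) (g : G) (p : ι →₀ V) (i : ι) :
    ρ.finsupp ι g p i = ρ g (p i) := by
  classical
  have h : Finsupp.lapply i ∘ₗ ρ.finsupp ι g = ρ g ∘ₗ Finsupp.lapply i :=
    Finsupp.lhom_ext fun j v => by
      simp [Finsupp.single_apply, apply_ite (ρ g)]
  exact LinearMap.congr_fun h p

/-! ### Detecting vectors by functionals -/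

theorem eq_zero_of_forall_dual_lTensor_eq_zero {𝕜 M N : Type*} [Field 𝕜] [AddCommGroup M]
    [Module 𝕜 M] [AddCommGroup N] [Module 𝕜 N] {z : M ⊗[𝕜] N}
    (hz : ∀ α : Module.Dual 𝕜 N, α.lTensor M z = 0) : z = 0 := by
  classical
  let b := Module.Basis.ofVectorSpace 𝕜 N
  refine (TensorProduct.equivFinsuppOfBasisRight b).injective (Finsupp.ext fun i => ?_)
  rw [map_zero, Finsupp.zero_apply, TensorProduct.equivFinsuppOfBasisRight_apply, hz, map_zero]

theorem eq_zero_of_forall_dual_rTensor_eq_zero {𝕜 M N : Type*} [Field 𝕜] [AddCommGroup M]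
    [Module 𝕜 M] [AddCommGroup N] [Module 𝕜 N] {z : M ⊗[𝕜] N}
    (hz : ∀ α : Module.Dual 𝕜 M, α.rTensor N z = 0) : z = 0 := by
  refine (TensorProduct.comm 𝕜 M N).map_eq_zero_iff.1
    (eq_zero_of_forall_dual_lTensor_eq_zero fun α => ?_)
  rw [← LinearMap.comm_comp_rTensor_comp_comm_eq]
  simp [hz]

theorem rid_lTensor_rTensor {R M M' N : Type*} [CommSemiring R] [AddCommMonoid M] [Module R M]
    [AddCommMonoid M'] [Module R M'] [AddCommMonoid N] [Module R N] (f : M →ₗ[R] M')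
    (α : Module.Dual R N) (z : M ⊗[R] N) :
    TensorProduct.rid R M' (α.lTensor M' (f.rTensor N z)) =
      f (TensorProduct.rid R M (α.lTensor M z)) := by
  induction z with
  | zero => simp only [map_zero]
  | tmul x y =>
    simp only [LinearMap.rTensor_tmul, LinearMap.lTensor_tmul, TensorProduct.rid_tmul, map_smul]
  | add s t hs ht => simp only [map_add, hs, ht]

theorem mem_range_rTensor_subtype_iff_forall_dual {𝕜 M N : Type*} [Field 𝕜] [AddCommGroup M]
    [Module 𝕜 M] [AddCommGroup N] [Module 𝕜 N] {P : Submodule 𝕜 M} {z : M ⊗[𝕜] N} :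
    z ∈ LinearMap.range (P.subtype.rTensor N) ↔
      ∀ α : Module.Dual 𝕜 N, TensorProduct.rid 𝕜 M (α.lTensor M z) ∈ P := by
  constructor
  · rintro ⟨t, rfl⟩ α
    rw [rid_lTensor_rTensor]
    exact Subtype.property _
  · intro hz
    rw [← rTensor_mkQ, LinearMap.mem_ker]
    refine eq_zero_of_forall_dual_lTensor_eq_zero fun α =>
      (TensorProduct.rid 𝕜 _).map_eq_zero_iff.1 ?_
    rw [rid_lTensor_rTensor, P.mkQ_apply, (Submodule.Quotient.mk_eq_zero P).2 (hz α)]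

theorem eq_top_of_forall_comp_mem {𝕜 V Z ι : Type*} [Field 𝕜] [AddCommGroup V]
    [Module 𝕜 V] [AddCommGroup Z] [Module 𝕜 Z] [FiniteDimensional 𝕜 Z] {β : ι → Z →ₗ[𝕜] V}
    (hβ : ∀ z, (∀ i, β i z = 0) → z = 0) {S : Submodule 𝕜 (Z →ₗ[𝕜] V)}
    (hS : ∀ (h : Module.End 𝕜 V) (i : ι), h ∘ₗ β i ∈ S) : S = ⊤ := by
  have hspan : Submodule.span 𝕜 {α : Z →ₗ[𝕜] 𝕜 | ∃ (γ : V →ₗ[𝕜] 𝕜) (i : ι), α = γ ∘ₗ β i} = ⊤ := by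
    refine Submodule.span_eq_top_of_ne_zero fun z hz => ?_
    obtain ⟨i, hi⟩ := not_forall.1 fun h => hz (hβ z h)
    obtain ⟨γ, hγ⟩ := Module.Projective.exists_dual_ne_zero 𝕜 hi
    exact ⟨_, ⟨γ, i, rfl⟩, hγ⟩
  have hrank : ∀ (α : Z →ₗ[𝕜] 𝕜) (v : V), α.smulRight v ∈ S := fun α v => by
    have hα : α ∈ Submodule.span 𝕜 _ := hspan ▸ Submodule.mem_top
    refine (Submodule.span_le (p := S.comap (LinearMap.smulRightₗ.flip v))).2 ?_ hα
    rintro _ ⟨γ, i, rfl⟩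
    exact hS (γ.smulRight v) i
  refine eq_top_iff.2 fun φ _ => ?_
  let b := Module.finBasis 𝕜 Z
  have hφ : φ = ∑ j, (b.coord j).smulRight (φ (b j)) := b.ext fun k => by
    simp [Finsupp.single_apply]
  rw [hφ]
  exact sum_mem fun j _ => hrank _ _

/-! ### Isotypic decomposition -/

section DensityTheorem

variable {k R ι : Type*} {S : ι → Type*} [Field k] [IsAlgClosed k] [Finite ι]
  [∀ i, AddCommGroup (S i)] [∀ i, Module k (S i)] [∀ i, FiniteDimensional k (S i)]

theorem exists_forall_end_pi_apply_eq_smul [Ring R] [Algebra k R] [∀ i, Module R (S i)]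
    [∀ i, IsScalarTower k R (S i)] [∀ i, IsSimpleModule R (S i)]
    (hS : Pairwise fun i j => IsEmpty (S i ≃ₗ[R] S j)) (φ : Module.End R (∀ i, S i)) (i : ι) :
    ∃ c : k, ∀ x, φ x i = c • x i := by
  classical
  let entry (j : ι) : S j →ₗ[R] S i := LinearMap.proj i ∘ₗ φ ∘ₗ LinearMap.single R S j
  obtain ⟨c, hc⟩ := (IsSimpleModule.algebraMap_end_bijective_of_isAlgClosed k).2 (entry i)
  have hφ : LinearMap.proj i ∘ₗ φ.restrictScalars k = c • LinearMap.proj i :=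
    LinearMap.pi_ext fun j x => by
      by_cases hji : j = i
      · subst hji
        simpa [entry] using (LinearMap.congr_fun hc x).symm
      · have hentry : entry j = 0 := (LinearMap.bijective_or_eq_zero _).resolve_left
          fun h => (hS hji).false (LinearEquiv.ofBijective _ h)
        simpa [Pi.single_eq_of_ne' hji, entry] using LinearMap.congr_fun hentry x
  exact ⟨c, LinearMap.congr_fun hφ⟩

theorem exists_forall_smul_eq [Ring R] [Algebra k R] [∀ i, Module R (S i)]
    [∀ i, IsScalarTower k R (S i)] [∀ i, IsSimpleModule R (S i)]
    (hS : Pairwise fun i j => IsEmpty (S i ≃ₗ[R] S j)) (T : ∀ i, Module.End k (S i)) :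
    ∃ r : R, ∀ i x, r • x = T i x := by
  classical
  let f : Module.End (Module.End R (∀ i, S i)) (∀ i, S i) :=
    { toFun := fun x i => T i (x i)
      map_add' := fun x y => funext fun i => map_add _ _ _
      map_smul' := fun φ x => funext fun i => by
        obtain ⟨c, hc⟩ := exists_forall_end_pi_apply_eq_smul (k := k) hS φ i
        change T i (φ x i) = φ _ i
        rw [hc, hc, map_smul] }
  have : Module.Finite (Module.End R (∀ i, S i)) (∀ i, S i) := .of_restrictScalars_finite k _ _
  obtain ⟨r, hr⟩ := Module.Finite.toModuleEnd_moduleEnd_surjective f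
  refine ⟨r, fun i x => ?_⟩
  have hri := congrFun (LinearMap.congr_fun hr (Pi.single i x)) i
  simpa [f] using hri

theorem exists_forall_asAlgebraHom_eq {G : Type*} [Monoid G] (σ : ∀ i, Representation k G (S i))
    [∀ i, (σ i).IsIrreducible] (hσ : Pairwise fun i j => IsEmpty ((σ i).Equiv (σ j)))
    (T : ∀ i, Module.End k (S i)) : ∃ r : k[G], ∀ i, (σ i).asAlgebraHom r = T i := by
  have (i : ι) : FiniteDimensional k (σ i).asModule := inferInstanceAs (FiniteDimensional k (S i))
  obtain ⟨r, hr⟩ := exists_forall_smul_eq (R := k[G]) (S := fun i => (σ i).asModule)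
    (fun i j hij => ⟨fun e => (hσ hij).false <|
      ((Representation.IntertwiningMap.equivLinearMapAsModule (σ i) (σ j)).symm
        e.toLinearMap).ofBijective e.bijective⟩) T
  exact ⟨r, fun i => LinearMap.ext fun x => hr i x⟩

end DensityTheorem

theorem intertwiningMap_asAlgebraHom_apply {k G V Z : Type*} [CommSemiring k] [Monoid G]
    [AddCommMonoid V] [Module k V] [AddCommMonoid Z] [Module k Z] {τ : Representation k G Z}
    {ρ : Representation k G V} (f : τ.IntertwiningMap ρ) (r : k[G]) (z : Z) :
    f (τ.asAlgebraHom r z) = ρ.asAlgebraHom r (f z) :=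
  (Representation.IntertwiningMap.equivLinearMapAsModule τ ρ f).map_smul r z

section IsotypicEval

variable {k G V Λ : Type*} {S : Λ → Type*} [Field k] [Monoid G] [AddCommGroup V] [Module k V]
  [∀ l, AddCommGroup (S l)] [∀ l, Module k (S l)]
  (σ : ∀ l, Representation k G (S l)) (ρ : Representation k G V)

/-- The evaluation map `⨁ Sₗ ⊗ Hom_G(Sₗ, V) → V`, `w ⊗ f ↦ f w`. -/
noncomputable def isotypicEval : (⨁ l, S l ⊗[k] (σ l).IntertwiningMap ρ) →ₗ[k] V :=
  open Classical in
  DirectSum.toModule k Λ V fun l => TensorProduct.lift <|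
    LinearMap.mk₂ k (fun w f => f w)
      (fun _ _ _ => by simp) (fun _ _ _ => by simp) (fun _ _ _ => rfl) (fun _ _ _ => rfl)

theorem isotypicEval_lof_tmul [inst : DecidableEq Λ] (l : Λ) (w : S l)
    (f : (σ l).IntertwiningMap ρ) :
    isotypicEval σ ρ (DirectSum.lof k Λ _ l (w ⊗ₜ f)) = f w := by
  obtain rfl : inst = fun _ _ => Classical.propDecidable _ := Subsingleton.elim _ _
  classical exact DirectSum.toModule_lof k l _

theorem asAlgebraHom_isotypicEval (r : k[G]) (z : ⨁ l, S l ⊗[k] (σ l).IntertwiningMap ρ) :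
    ρ.asAlgebraHom r (isotypicEval σ ρ z) =
      isotypicEval σ ρ (DirectSum.lmap (fun l => ((σ l).asAlgebraHom r).rTensor _) z) := by
  classical
  have h : ρ.asAlgebraHom r ∘ₗ isotypicEval σ ρ =
      isotypicEval σ ρ ∘ₗ DirectSum.lmap (fun l => ((σ l).asAlgebraHom r).rTensor _) :=
    DirectSum.linearMap_ext _ fun l => TensorProduct.ext' fun w f => by
      simp only [LinearMap.comp_apply, DirectSum.lmap_lof, LinearMap.rTensor_tmul,
        isotypicEval_lof_tmul, intertwiningMap_asAlgebraHom_apply]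
  exact LinearMap.congr_fun h z

theorem isotypicEval_lof_smulRight_rTensor [DecidableEq Λ] (l : Λ) (α : Module.Dual k (S l))
    (w : S l) (t : S l ⊗[k] (σ l).IntertwiningMap ρ) :
    isotypicEval σ ρ (DirectSum.lof k Λ _ l ((α.smulRight w).rTensor _ t)) =
      TensorProduct.lid k _ (α.rTensor _ t) w := by
  induction t with
  | zero => simp only [map_zero]; rfl
  | tmul x f => simp [isotypicEval_lof_tmul]
  | add s t hs ht => simp only [map_add, hs, ht]; rfl

theorem isotypicEval_injective [IsAlgClosed k] [∀ l, FiniteDimensional k (S l)]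
    [∀ l, (σ l).IsIrreducible] (hσ : Pairwise fun l m => IsEmpty ((σ l).Equiv (σ m))) :
    Function.Injective (isotypicEval σ ρ) := by
  classical
  refine (injective_iff_map_eq_zero _).2 fun z hz => DFinsupp.ext fun l => ?_
  refine eq_zero_of_forall_dual_rTensor_eq_zero fun α =>
    (TensorProduct.lid k _).injective <| Representation.IntertwiningMap.ext <|
      LinearMap.ext fun w => ?_
  let T : ∀ m, Module.End k (S m) := Pi.single l (α.smulRight w)
  obtain ⟨r, hr⟩ := exists_forall_asAlgebraHom_eq (fun m : ↥(insert l z.support) => σ m)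
    (fun m n h => hσ (Subtype.coe_ne_coe.2 h)) (fun m => T m)
  have hrz : DirectSum.lmap (fun m => ((σ m).asAlgebraHom r).rTensor _) z =
      DirectSum.lof k Λ _ l ((α.smulRight w).rTensor _ (z l)) := DFinsupp.ext fun m => by
    rw [DirectSum.lmap_apply]
    obtain rfl | hml := eq_or_ne m l
    · rw [hr ⟨m, Finset.mem_insert_self _ _⟩, DirectSum.lof_apply]
      simp only [T, Pi.single_eq_same]
    · rw [DirectSum.lof_eq_of, DirectSum.of_eq_of_ne _ _ _ hml]
      by_cases hm : m ∈ z.support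
      · rw [hr ⟨m, Finset.mem_insert_of_mem hm⟩]
        simp only [T, Pi.single_eq_of_ne hml, LinearMap.rTensor_zero, LinearMap.zero_apply]
      · rw [DFinsupp.notMem_support_iff.1 hm, map_zero]
  have hw := isotypicEval_lof_smulRight_rTensor σ ρ l α w (z l)
  rw [← hrz, ← asAlgebraHom_isotypicEval, hz, map_zero] at hw
  rw [map_zero]
  exact hw.symm

variable {σ ρ} in
theorem exists_intertwiningMap_isotypicEval_eq (h : Function.Bijective (isotypicEval σ ρ)) (l : Λ)
    (α : Module.Dual k ((σ l).IntertwiningMap ρ)) :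
    ∃ φ : ρ.IntertwiningMap (σ l), ∀ z,
      φ (isotypicEval σ ρ z) = TensorProduct.rid k _ (α.lTensor _ (z l)) := by
  let e := LinearEquiv.ofBijective _ h
  let c : (⨁ l, S l ⊗[k] (σ l).IntertwiningMap ρ) →ₗ[k] S l :=
    (TensorProduct.rid k _).toLinearMap ∘ₗ α.lTensor _ ∘ₗ DirectSum.component k Λ _ l
  have hce : ∀ z, (c ∘ₗ e.symm.toLinearMap) (isotypicEval σ ρ z) = c z := fun z =>
    congrArg c (e.symm_apply_apply z)
  refine ⟨⟨c ∘ₗ e.symm.toLinearMap, fun g => LinearMap.ext fun v => ?_⟩, hce⟩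
  obtain ⟨z, rfl⟩ := h.2 v
  have hg := asAlgebraHom_isotypicEval σ ρ (MonoidAlgebra.of k G g) z
  simp only [Representation.asAlgebraHom_of] at hg
  calc (c ∘ₗ e.symm.toLinearMap) (ρ g (isotypicEval σ ρ z))
      = c (DirectSum.lmap (fun m => (σ m g).rTensor _) z) := by rw [hg, hce]
    _ = σ l g (c z) := rid_lTensor_rTensor (σ l g) α (z l)
    _ = σ l g ((c ∘ₗ e.symm.toLinearMap) (isotypicEval σ ρ z)) := by rw [hce]

end IsotypicEval

/-- The `k[G]`-module of a subrepresentation, as a submodule of the ambient `k[G]`-module. -/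
noncomputable def asModuleEquivAsSubmodule {k G V : Type*} [Field k] [Group G] [AddCommGroup V]
    [Module k V] {ρ : Representation k G V} (X : Subrepresentation ρ) :
    X.toRepresentation.asModule ≃ₗ[k[G]] X.asSubmodule :=
  (LinearEquiv.ofInjective
    (Representation.IntertwiningMap.equivLinearMapAsModule _ _ (subrepresentationSubtype X))
    X.toSubmodule.subtype_injective).trans
    (LinearEquiv.ofEq _ _ (SetLike.coe_injective Subtype.range_coe))

namespace IsWeaklyContinuous

variable {𝕜 G V : Type*} [RCLike 𝕜] [Group G] [TopologicalSpace G] [AddCommGroup V] [Module 𝕜 V]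
  {ρ : Representation 𝕜 G V} [CompactSpace G] [IsTopologicalGroup G]

theorem isSemisimpleModule_asModule (hρ : IsWeaklyContinuous ρ) :
    IsSemisimpleModule 𝕜[G] ρ.asModule := by
  refine isSemisimpleModule_of_isSemisimpleModule_submodule'
    (p := fun X : {X : Subrepresentation ρ // FiniteDimensional 𝕜 X.toSubmodule} =>
      X.1.asSubmodule) (fun ⟨X, hX⟩ => ?_) (eq_top_iff.2 fun v _ => ?_)
  · have := (Representation.isSemisimpleRepresentation_iff_isSemisimpleModule_asModule _).1
      (hρ.toRepresentation X).isSemisimpleRepresentation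
    exact .congr (asModuleEquivAsSubmodule X).symm
  · obtain ⟨X, hX, hv⟩ := hρ.exists_finiteDimensional_subrepresentation v
    exact Submodule.mem_iSup_of_mem ⟨X, hX⟩ hv

theorem eq_top_of_forall_irreducible_le (hρ : IsWeaklyContinuous ρ) {N : Submodule 𝕜 V}
    (hN : ∀ Y : Subrepresentation ρ, Y.toRepresentation.IsIrreducible → Y.toSubmodule ≤ N) :
    N = ⊤ := by
  have := hρ.isSemisimpleModule_asModule
  refine eq_top_iff.2 fun (v : ρ.asModule) _ => ?_
  have hv : v ∈ sSup {M : Submodule 𝕜[G] ρ.asModule | IsSimpleModule 𝕜[G] M} := by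
    rw [IsSemisimpleModule.sSup_simples_eq_top]
    exact Submodule.mem_top
  rw [sSup_eq_iSup'] at hv
  induction hv using Submodule.iSup_induction' with
  | mem M x hx =>
    let Y := Subrepresentation.ofSubmodule' M.1
    have : IsSimpleModule 𝕜[G] Y.asSubmodule := M.2
    exact hN Y ((Representation.irreducible_iff_isSimpleModule_asModule _).2
      (.congr (asModuleEquivAsSubmodule Y))) hx
  | zero => exact zero_mem N
  | add x y _ _ hx hy => exact add_mem (hx trivial) (hy trivial)

theorem isotypicEval_surjective (hρ : IsWeaklyContinuous ρ) {Λ : Type*} {S : Λ → Type*}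
    [∀ l, AddCommGroup (S l)] [∀ l, Module 𝕜 (S l)] {σ : ∀ l, Representation 𝕜 G (S l)}
    (hσ : ∀ Y : Subrepresentation ρ, Y.toRepresentation.IsIrreducible →
      ∃ l, Nonempty (Y.toRepresentation.Equiv (σ l))) :
    Function.Surjective (isotypicEval σ ρ) := by
  classical
  refine LinearMap.range_eq_top.1 (hρ.eq_top_of_forall_irreducible_le fun Y hY y hy => ?_)
  obtain ⟨l, ⟨e⟩⟩ := hσ Y hY
  refine ⟨DirectSum.lof 𝕜 Λ _ l
    (e ⟨y, hy⟩ ⊗ₜ (subrepresentationSubtype Y).comp e.symm.toIntertwiningMap), ?_⟩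
  rw [isotypicEval_lof_tmul]
  exact congrArg Subtype.val (e.toLinearEquiv.symm_apply_apply ⟨y, hy⟩)

end IsWeaklyContinuous

/-! ### Modes of a simple vertex operator algebra -/

open Filter in
theorem int_induction_from_top {P : ℤ → Prop} (htop : ∀ᶠ n in atTop, P n)
    (step : ∀ n, (∀ m, n < m → P m) → P n) (n : ℤ) : P n := by
  obtain ⟨N, hN⟩ := eventually_atTop.1 htop
  have key : ∀ k : ℕ, ∀ n, N ≤ n + k → P n := by
    intro k
    induction k with
    | zero => exact fun n hn => hN n (by simpa using hn)
    | succ k ih => exact fun n hn => step n fun m hm => ih m (by push_cast at hn; lia)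
  exact key (N - n).toNat n (by lia)

theorem ringChoose_natCast_eq_zero {k i : ℕ} (h : k < i) : Ring.choose (k : ℤ) i = 0 := by
  rw [Ring.choose_natCast, Nat.choose_eq_zero_of_lt h, Nat.cast_zero]

namespace VOA

section VertexAlgebra

variable {V : Type*} [AddCommGroup V] [Module ℂ V] (A : VOA V)

section Modes

open Filter Finset

theorem eventually_mode_apply_eq_zero (u v : V) : ∀ᶠ n in atTop, A.mode u n v = 0 :=
  (eventually_gt_atTop (-HahnSeries.order ((HahnModule.of ℂ).symm (A.Y u v)))).mono
    fun _ hn => VertexOperator.ncoeff_eq_zero_of_lt_order _ _ _ (by lia)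

theorem eventually_mode_comp_eq_zero {Z : Type*} [AddCommGroup Z] [Module ℂ Z]
    [FiniteDimensional ℂ Z] (u : V) (β : Z →ₗ[ℂ] V) :
    ∀ᶠ n in atTop, A.mode u n ∘ₗ β = 0 := by
  let b := Module.finBasis ℂ Z
  filter_upwards [eventually_all.2 fun i => A.eventually_mode_apply_eq_zero u (β (b i))]
    with n hn using b.ext hn

theorem mode_vac_neg_one : A.mode A.vac (-1) = 1 :=
  LinearMap.ext fun v => (A.vac_mode (-1) v).trans (if_pos rfl)

/-- Weak associativity: the Jacobi identity with `p = k` large enough to kill `u_{p + i} w`. -/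
theorem sum_mode_mode_apply {u v w : V} {k m : ℕ} {b : ℤ} (r : ℤ)
    (hu : ∀ n : ℤ, k ≤ n → A.mode u n w = 0) (hv : ∀ n : ℤ, b + m < n → A.mode v n w = 0) :
    ∑ i ∈ range (k + 1), Ring.choose (k : ℤ) i • A.mode (A.mode u (r + i) v) (k + b - i) w =
      ∑ i ∈ range (m + 1), ((-1 : ℤ) ^ i * Ring.choose r i) •
        A.mode u (k + r - i) (A.mode v (b + i) w) := by
  have hJ := A.jacobi u v w k b r
  rw [finsum_eq_sum_of_support_subset (s := range (k + 1)),
    finsum_eq_sum_of_support_subset (s := range (m + 1))] at hJ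
  · rw [hJ]
    refine sum_congr rfl fun i _ => ?_
    rw [show VertexOperator.ncoeff (A.Y u) (k + i) w = 0 from hu _ (by lia), map_zero, smul_zero,
      sub_zero]
  · refine Function.support_subset_iff'.2 fun i hi => ?_
    have hi' : m < i := by simpa using hi
    rw [show VertexOperator.ncoeff (A.Y u) (k + i) w = 0 from hu _ (by lia),
      show VertexOperator.ncoeff (A.Y v) (b + i) w = 0 from hv _ (by lia)]
    simp only [map_zero, smul_zero, sub_zero]
  · refine Function.support_subset_iff'.2 fun i hi => ?_
    rw [ringChoose_natCast_eq_zero (by simpa using hi), zero_smul]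

/-- Solving weak associativity for its leading term reduces a product `u_a v_b` to single modes and
products with larger second index. -/
theorem mode_apply_mode_apply {u v w : V} {k m : ℕ} {b : ℤ} (a : ℤ)
    (hu : ∀ n : ℤ, k ≤ n → A.mode u n w = 0) (hv : ∀ n : ℤ, b + m < n → A.mode v n w = 0) :
    A.mode u a (A.mode v b w) =
      ∑ i ∈ range (k + 1), Ring.choose (k : ℤ) i •
          A.mode (A.mode u (a - k + i) v) (k + b - i) w -
        ∑ i ∈ range m, ((-1 : ℤ) ^ (i + 1) * Ring.choose (a - k) (i + 1)) •
          A.mode u (a - (i + 1)) (A.mode v (b + (i + 1)) w) := by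
  rw [A.sum_mode_mode_apply (a - k) hu hv, sum_range_succ', eq_sub_iff_add_eq, add_comm]
  simp only [Nat.cast_add, Nat.cast_one, Nat.cast_zero, pow_zero, Ring.choose_zero_right, mul_one,
    one_smul, sub_zero, add_zero, add_sub_cancel]

/-- The `n`-th mode as a linear function of the state. -/
def modeMap (n : ℤ) : V →ₗ[ℂ] Module.End ℂ V :=
  LinearMap.proj n ∘ₗ VertexOperator.ncoeff ∘ₗ A.Y

variable {Z ι : Type*} [AddCommGroup Z] [Module ℂ Z] (β : ι → Z →ₗ[ℂ] V)

/-- The linear map sending a finitely supported family `(a_{i,m})` of states to the sum of the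
operators `(a_{i,m})_m ∘ β i`. -/
noncomputable def modeComb : (ι × ℤ →₀ V) →ₗ[ℂ] Z →ₗ[ℂ] V :=
  Finsupp.lsum ℂ fun q => LinearMap.lcomp ℂ V (β q.1) ∘ₗ A.modeMap q.2

@[simp]
theorem modeComb_single (i : ι) (n : ℤ) (u : V) :
    A.modeComb β (Finsupp.single (i, n) u) = A.mode u n ∘ₗ β i :=
  Finsupp.lsum_single _ _ _ _

theorem mode_comp_mem_range_modeComb (i : ι) (n : ℤ) (u : V) :
    A.mode u n ∘ₗ β i ∈ LinearMap.range (A.modeComb β) :=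
  ⟨_, A.modeComb_single β i n u⟩

theorem mode_comp_mode_comp_mem_range_modeComb [FiniteDimensional ℂ Z] (i : ι) (u v : V)
    (a b : ℤ) : A.mode u a ∘ₗ A.mode v b ∘ₗ β i ∈ LinearMap.range (A.modeComb β) := by
  obtain ⟨N, hN⟩ := eventually_atTop.1 (A.eventually_mode_comp_eq_zero u (β i))
  let k := N.toNat
  induction b using int_induction_from_top generalizing a with
  | htop =>
    filter_upwards [A.eventually_mode_comp_eq_zero v (β i)] with b hb a
    rw [hb, LinearMap.comp_zero]
    exact zero_mem _
  | step b ih =>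
    obtain ⟨m, hm⟩ := eventually_atTop.1 (A.eventually_mode_comp_eq_zero v (β i))
    have hred : A.mode u a ∘ₗ A.mode v b ∘ₗ β i =
        ∑ j ∈ range (k + 1), Ring.choose (k : ℤ) j •
            (A.mode (A.mode u (a - k + j) v) (k + b - j) ∘ₗ β i) -
          ∑ j ∈ range (m - b).toNat, ((-1 : ℤ) ^ (j + 1) * Ring.choose (a - k) (j + 1)) •
            (A.mode u (a - (j + 1)) ∘ₗ A.mode v (b + (j + 1)) ∘ₗ β i) := by
      ext z
      simp only [LinearMap.sub_apply, LinearMap.sum_apply, LinearMap.smul_apply]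
      exact A.mode_apply_mode_apply a (fun n hn => LinearMap.congr_fun (hN n (by lia)) z)
        fun n hn => LinearMap.congr_fun (hm n (by lia)) z
    rw [hred]
    exact sub_mem (sum_mem fun j _ => zsmul_mem (A.mode_comp_mem_range_modeComb β i _ _) _)
      (sum_mem fun j _ => zsmul_mem (ih _ (by lia) _) _)

end Modes

section Density

variable {Z ι : Type*} [AddCommGroup Z] [Module ℂ Z] (β : ι → Z →ₗ[ℂ] V)

/-- The associative algebra generated by all modes. -/
def modeAlgebra : Subalgebra ℂ (Module.End ℂ V) :=
  Algebra.adjoin ℂ (Set.range fun q : V × ℤ => A.mode q.1 q.2)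

theorem mode_mem_modeAlgebra (u : V) (n : ℤ) : A.mode u n ∈ A.modeAlgebra :=
  Algebra.subset_adjoin ⟨(u, n), rfl⟩

theorem apply_mem_of_mem_modeAlgebra {M : Type*} [AddCommGroup M] [Module ℂ M]
    (Φ : Module.End ℂ V →ₐ[ℂ] Module.End ℂ M) {S : Submodule ℂ M}
    (hS : ∀ u n, ∀ x ∈ S, Φ (A.mode u n) x ∈ S) {r : Module.End ℂ V} (hr : r ∈ A.modeAlgebra) :
    ∀ x ∈ S, Φ r x ∈ S := by
  induction hr using Algebra.adjoin_induction with
  | mem r hr =>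
    obtain ⟨q, rfl⟩ := hr
    exact hS q.1 q.2
  | algebraMap c =>
    rw [AlgHom.commutes]
    exact fun x hx => S.smul_mem c hx
  | add r s _ _ hr hs =>
    rw [map_add]
    exact fun x hx => add_mem (hr x hx) (hs x hx)
  | mul r s _ _ hr hs =>
    rw [map_mul]
    exact fun x hx => hr _ (hs x hx)

theorem gr_eq_eigenspace (n : ℤ) :
    A.gr n = Module.End.eigenspace (A.mode A.conf 1) (n : ℂ) := by
  have hind : iSupIndep fun n : ℤ => Module.End.eigenspace (A.mode A.conf 1) (n : ℂ) :=
    (Module.End.eigenspaces_iSupIndep _).comp Int.cast_injective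
  exact congrFun ((hind.le_iff_eq_of_iSup_eq_top A.gr_internal.submodule_iSup_eq_top).1
    fun n v hv => Module.End.mem_eigenspace_iff.2 (A.weight n v hv)) n

namespace IsSimple

variable {A} (hA : A.IsSimple)
include hA

theorem isSimpleModule_modeAlgebra : IsSimpleModule A.modeAlgebra V := by
  have := hA.1
  refine (isSimpleModule_iff _ _).2 { eq_bot_or_eq_top := fun N => ?_ }
  simpa only [Submodule.restrictScalars_eq_bot_iff, Submodule.restrictScalars_eq_top_iff] using
    hA.2 (N.restrictScalars ℂ) fun u n x hx =>
      N.smul_mem ⟨A.mode u n, A.mode_mem_modeAlgebra u n⟩ hx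

theorem exists_gr_ne_bot : ∃ n, A.gr n ≠ ⊥ := by
  by_contra! hgr
  have := hA.1
  exact bot_ne_top ((iSup_eq_bot.2 hgr).symm.trans A.gr_internal.submodule_iSup_eq_top)

theorem exists_eq_smul (φ : Module.End A.modeAlgebra V) : ∃ c : ℂ, ∀ v, φ v = c • v := by
  have := hA.isSimpleModule_modeAlgebra
  obtain ⟨n, hn⟩ := hA.exists_gr_ne_bot
  have := A.gr_finite n
  have := Submodule.nontrivial_iff_ne_bot.2 hn
  have hφ : ∀ x ∈ A.gr n, φ.restrictScalars ℂ x ∈ A.gr n := fun x hx => by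
    rw [gr_eq_eigenspace, Module.End.mem_eigenspace_iff] at hx ⊢
    calc A.mode A.conf 1 (φ x) = φ (A.mode A.conf 1 x) :=
          (φ.map_smul ⟨_, A.mode_mem_modeAlgebra A.conf 1⟩ x).symm
      _ = (n : ℂ) • φ x := by rw [hx, φ.map_smul_of_tower]
  obtain ⟨c, hc⟩ := Module.End.exists_eigenvalue ((φ.restrictScalars ℂ).restrict hφ)
  obtain ⟨x, hx, hx0⟩ := hc.exists_hasEigenvector
  have hx' : φ x = c • (x : V) := congrArg Subtype.val (Module.End.mem_eigenspace_iff.1 hx)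
  have hzero : φ - algebraMap ℂ _ c = 0 := (LinearMap.bijective_or_eq_zero _).resolve_left
    fun h => hx0 <| Subtype.ext <| h.1 <| by
      simp [hx']
  exact ⟨c, fun v => sub_eq_zero.1 (LinearMap.congr_fun hzero v)⟩

theorem exists_mem_modeAlgebra_eqOn (h : Module.End ℂ V) (s : Finset V) :
    ∃ r ∈ A.modeAlgebra, ∀ v ∈ s, r v = h v := by
  have := hA.isSimpleModule_modeAlgebra
  let f : Module.End (Module.End A.modeAlgebra V) V :=
    { h with
      map_smul' := fun φ v => by
        obtain ⟨c, hc⟩ := hA.exists_eq_smul φ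
        change h (φ v) = φ (h v)
        rw [hc, hc, map_smul] }
  obtain ⟨r, hr⟩ := jacobson_density (R := A.modeAlgebra) f s
  exact ⟨r, r.2, fun v hv => (hr v hv).symm⟩

end IsSimple

variable {β}
theorem mode_comp_mem_range_modeComb_of_mem [FiniteDimensional ℂ Z] {φ : Z →ₗ[ℂ] V}
    (hφ : φ ∈ LinearMap.range (A.modeComb β)) (u : V) (n : ℤ) :
    A.mode u n ∘ₗ φ ∈ LinearMap.range (A.modeComb β) := by
  obtain ⟨p, rfl⟩ := hφ
  induction p using Finsupp.induction_linear with
  | zero =>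
    rw [map_zero, LinearMap.comp_zero]
    exact zero_mem _
  | add p q hp hq =>
    rw [map_add, LinearMap.comp_add]
    exact add_mem hp hq
  | single q v =>
    rw [modeComb_single]
    exact A.mode_comp_mode_comp_mem_range_modeComb β q.1 u v n q.2

theorem IsSimple.range_modeComb_eq_top {A : VOA V} (hA : A.IsSimple) [FiniteDimensional ℂ Z]
    (hβ : ∀ z, (∀ i, β i z = 0) → z = 0) : LinearMap.range (A.modeComb β) = ⊤ := by
  classical
  let b := Module.finBasis ℂ Z
  refine eq_top_of_forall_comp_mem hβ fun h i => ?_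
  obtain ⟨r, hr, hrh⟩ := hA.exists_mem_modeAlgebra_eqOn h (Finset.univ.image (β i ∘ b))
  have hβi : β i ∈ LinearMap.range (A.modeComb β) := by
    have hvac := A.mode_comp_mem_range_modeComb β i (-1) A.vac
    rwa [mode_vac_neg_one, Module.End.one_eq_id, LinearMap.id_comp] at hvac
  have hcomp : h ∘ₗ β i = r ∘ₗ β i := b.ext fun j =>
    (hrh _ (Finset.mem_image_of_mem _ (Finset.mem_univ j))).symm
  rw [hcomp]
  exact A.apply_mem_of_mem_modeAlgebra (Algebra.lsmul ℂ ℂ (Z →ₗ[ℂ] V))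
    (fun u n φ hφ => A.mode_comp_mem_range_modeComb_of_mem hφ u n) hr _ hβi

end Density

section Tensor
open Filter Finset

/-- The linear map `u ⊗ v ↦ u_n v`. -/
noncomputable def modeTensor (n : ℤ) : V ⊗[ℂ] V →ₗ[ℂ] V :=
  TensorProduct.lift (A.modeMap n)

@[simp]
theorem modeTensor_tmul (n : ℤ) (u v : V) : A.modeTensor n (u ⊗ₜ v) = A.mode u n v := rfl

/-- Weak commutativity: the Jacobi identity with `r = k` large enough to kill `a_{r + i} u`. -/
theorem sum_mode_commutator_eq_zero {a u : V} {k : ℕ} (hk : ∀ n : ℤ, k ≤ n → A.mode a n u = 0)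
    (p q : ℤ) (v : V) :
    ∑ i ∈ range (k + 1), ((-1 : ℤ) ^ i * Ring.choose (k : ℤ) i) •
      (A.mode a (p + k - i) (A.mode u (q + i) v) -
        (Int.negOnePow k : ℤ) • A.mode u (q + k - i) (A.mode a (p + i) v)) = 0 := by
  have hJ := A.jacobi a u v p q k
  rw [finsum_eq_zero_of_forall_eq_zero fun i => ?_,
    finsum_eq_sum_of_support_subset (s := range (k + 1))] at hJ
  · exact hJ.symm
  · refine Function.support_subset_iff'.2 fun i hi => ?_
    rw [ringChoose_natCast_eq_zero (by simpa using hi), mul_zero, zero_smul]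
  · rw [show VertexOperator.ncoeff (A.Y a) (k + i) u = 0 from hk _ (by lia)]
    simp only [map_zero, Pi.zero_apply, LinearMap.zero_apply, smul_zero]

theorem eventually_sum_modeTensor_commutator_eq_zero (a : V) (z : V ⊗[ℂ] V) :
    ∀ᶠ k : ℕ in atTop, ∀ p q : ℤ,
      (∑ i ∈ range (k + 1), ((-1 : ℤ) ^ i * Ring.choose (k : ℤ) i) •
        (A.mode a (p + k - i) ∘ₗ A.modeTensor (q + i) -
          (Int.negOnePow k : ℤ) • A.modeTensor (q + k - i) ∘ₗ (A.mode a (p + i)).lTensor V)) z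
        = 0 := by
  induction z using TensorProduct.induction_on with
  | zero => exact .of_forall fun _ _ _ => map_zero _
  | add y z hy hz =>
    filter_upwards [hy, hz] with k hyk hzk p q
    rw [map_add, hyk, hzk, add_zero]
  | tmul u v =>
    obtain ⟨N, hN⟩ := eventually_atTop.1 (A.eventually_mode_apply_eq_zero a u)
    filter_upwards [eventually_ge_atTop N.toNat] with k hk p q
    simp only [LinearMap.sum_apply, LinearMap.smul_apply]
    exact A.sum_mode_commutator_eq_zero (fun n hn => hN n (by lia)) p q v

theorem eventually_lTensor_mode_eq_zero (a : V) (z : V ⊗[ℂ] V) :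
    ∀ᶠ n in atTop, (A.mode a n).lTensor V z = 0 := by
  induction z using TensorProduct.induction_on with
  | zero => exact .of_forall fun _ => map_zero _
  | add y z hy hz =>
    filter_upwards [hy, hz] with n hyn hzn
    rw [map_add, hyn, hzn, add_zero]
  | tmul u v =>
    filter_upwards [A.eventually_mode_apply_eq_zero a v] with n hn
    rw [LinearMap.lTensor_tmul, hn, TensorProduct.tmul_zero]

theorem modeTensor_lTensor_mode_eq_zero {z : V ⊗[ℂ] V} (hz : ∀ n, A.modeTensor n z = 0) (a : V)
    (p n : ℤ) : A.modeTensor n ((A.mode a p).lTensor V z) = 0 := by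
  induction p using int_induction_from_top generalizing n with
  | htop =>
    filter_upwards [A.eventually_lTensor_mode_eq_zero a z] with p hp n
    rw [hp, map_zero]
  | step p ih =>
    obtain ⟨k, hk⟩ := (A.eventually_sum_modeTensor_commutator_eq_zero a z).exists
    have hsum := hk p (n - k)
    rw [LinearMap.sum_apply, sum_eq_single_of_mem 0 (by simp)] at hsum
    · simpa [hz] using hsum
    · intro i _ hi
      have hih := ih (p + i) (by lia) (n - k + k - i)
      simp only [LinearMap.smul_apply, LinearMap.sub_apply, LinearMap.comp_apply, hz, hih, map_zero,
        smul_zero, sub_zero]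

theorem IsSimple.eq_zero_of_forall_modeTensor_eq_zero {A : VOA V} (hA : A.IsSimple)
    {z : V ⊗[ℂ] V} (hz : ∀ n, A.modeTensor n z = 0) : z = 0 := by
  let K : Submodule ℂ (V ⊗[ℂ] V) := ⨅ n, LinearMap.ker (A.modeTensor n)
  have hK : ∀ h : Module.End ℂ V, h.lTensor V z ∈ K := fun h => by
    classical
    obtain ⟨s, hs⟩ := TensorProduct.exists_finset z
    obtain ⟨r, hr, hrh⟩ := hA.exists_mem_modeAlgebra_eqOn h (s.image Prod.snd)
    have hrz : h.lTensor V z = r.lTensor V z := by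
      simp only [hs, map_sum, LinearMap.lTensor_tmul]
      exact sum_congr rfl fun x hx => by rw [hrh _ (mem_image_of_mem _ hx)]
    rw [hrz]
    refine A.apply_mem_of_mem_modeAlgebra (Module.End.lTensorAlgHom ℂ V V) (fun u n x hx => ?_) hr
      z (Submodule.mem_iInf _ |>.2 hz)
    exact Submodule.mem_iInf _ |>.2 fun m =>
      A.modeTensor_lTensor_mode_eq_zero (Submodule.mem_iInf _ |>.1 hx) u n m
  refine eq_zero_of_forall_dual_lTensor_eq_zero fun α => ?_
  have hcontract : A.modeTensor (-1) ∘ₗ (α.smulRight A.vac).lTensor V =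
      (TensorProduct.rid ℂ V).toLinearMap ∘ₗ α.lTensor V :=
    TensorProduct.ext' fun u v => by
      simp [mode, A.creation_neg_one]
  have hzero := LinearMap.congr_fun hcontract z
  rw [LinearMap.comp_apply, Submodule.mem_iInf _ |>.1 (hK (α.smulRight A.vac)) (-1)] at hzero
  exact (TensorProduct.rid ℂ V).map_eq_zero_iff.1 hzero.symm

end Tensor

end VertexAlgebra

/-! ### Equivariant maps and subalgebras -/

variable {V : Type*} [AddCommGroup V] [Module ℂ V] {A : VOA V} {G : Type*} [Group G]
  (act : G →* A.aut)

section Intertwiners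

variable {Z ι : Type*} [AddCommGroup Z] [Module ℂ Z] {τ : Representation ℂ G Z}

theorem rep_mode (g : G) (u v : V) (n : ℤ) :
    rep act g (A.mode u n v) = A.mode (rep act g u) n (rep act g v) :=
  (act g).2.2.2 u n v

theorem IsSubVOA.modeComb_apply_mem {U : Submodule ℂ V} (hU : A.IsSubVOA U)
    {β : ι → Z →ₗ[ℂ] V} {q : ι × ℤ →₀ V} (hq : ∀ i, q i ∈ U) {z : Z} (hz : ∀ i, β i z ∈ U) :
    A.modeComb β q z ∈ U := by
  rw [modeComb, Finsupp.lsum_apply, Finsupp.sum, LinearMap.sum_apply]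
  exact sum_mem fun i _ => hU.mode_mem _ (hq i) _ _ (hz _)

/-- `modeComb` is equivariant when the maps `β i` are. -/
noncomputable def modeCombIntertwining (β : ι → τ.IntertwiningMap (rep act)) :
    ((rep act).finsupp (ι × ℤ)).IntertwiningMap (τ.linHom (rep act)) where
  toLinearMap := A.modeComb fun i => (β i).toLinearMap
  isIntertwining' g := Finsupp.lhom_ext fun q u => LinearMap.ext fun z => by
    obtain ⟨i, n⟩ := q
    simp [Representation.linHom_apply, rep_mode, (β i).isIntertwining,
      -Module.End.mul_apply, -map_mul]

/-- `u ⊗ v ↦ u_n v` is equivariant. -/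
noncomputable def modeTensorIntertwining (n : ℤ) :
    ((rep act).tprod (rep act)).IntertwiningMap (rep act) where
  toLinearMap := A.modeTensor n
  isIntertwining' g := TensorProduct.ext' fun u v => (rep_mode act g u v n).symm

variable {act} [TopologicalSpace G] [IsTopologicalGroup G] [CompactSpace G]
  (hA : A.IsSimple) (hcont : ActsContinuously act) {U : Submodule ℂ V} (hU : A.IsSubVOA U)
  (hGU : (rep act).invariants ≤ U)
include hA hcont hU hGU

/-- Averaging over `G` makes the coefficients of an equivariant combination of modes invariant. -/
theorem intertwiningMap_mem_of_forall_mem [FiniteDimensional ℂ Z]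
    (φ : τ.IntertwiningMap (rep act)) {β : ι → τ.IntertwiningMap (rep act)}
    (hβ : ∀ z, (∀ i, β i z = 0) → z = 0) {z : Z} (hz : ∀ i, β i z ∈ U) : φ z ∈ U := by
  let β' : ι → Z →ₗ[ℂ] V := fun i => (β i).toLinearMap
  obtain ⟨p, hp⟩ := LinearMap.range_eq_top.1 (hA.range_modeComb_eq_top (β := β') hβ) φ.toLinearMap
  have hinv : modeCombIntertwining act β p ∈ (τ.linHom (rep act)).invariants := by
    rw [show modeCombIntertwining act β p = φ.toLinearMap from hp]
    exact (Representation.mem_linHom_invariants_iff_isIntertwining _).2 ⟨φ.isIntertwining⟩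
  obtain ⟨q, hq, hqp⟩ :=
    (IsWeaklyContinuous.finsupp hcont (ι × ℤ)).exists_mem_invariants_eq _ hinv
  have hqφ : A.modeComb β' q = φ.toLinearMap := Eq.trans hqp hp
  have hqU : ∀ i, q i ∈ U := fun i => hGU fun g => by
    rw [← finsupp_representation_apply, hq]
  rw [← φ.toLinearMap_apply, ← hqφ]
  exact hU.modeComb_apply_mem hqU hz

theorem intertwiningMap_mem_of_mem {X : Subrepresentation (rep act)}
    (φ : X.toRepresentation.IntertwiningMap (rep act)) {x : X.toSubmodule} (hx : (x : V) ∈ U) :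
    φ x ∈ U := by
  obtain ⟨X', _, hxX'⟩ := (IsWeaklyContinuous.toRepresentation hcont
    X).exists_finiteDimensional_subrepresentation x
  let ι := subrepresentationSubtype X'
  exact intertwiningMap_mem_of_forall_mem hA hcont hU hGU (φ.comp ι)
    (β := fun _ : Unit => (subrepresentationSubtype X).comp ι)
    (fun _ hz => Subtype.ext (Subtype.ext (hz ()))) (z := ⟨x, hxX'⟩) fun _ => hx

theorem intertwiningMap_tmul_mem_of_mem {X Y : Subrepresentation (rep act)}
    (φ : (X.toRepresentation.tprod Y.toRepresentation).IntertwiningMap (rep act))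
    {x : X.toSubmodule} (hx : (x : V) ∈ U) {y : Y.toSubmodule} (hy : (y : V) ∈ U) :
    φ (x ⊗ₜ y) ∈ U := by
  obtain ⟨X', _, hxX'⟩ := (IsWeaklyContinuous.toRepresentation hcont
    X).exists_finiteDimensional_subrepresentation x
  obtain ⟨Y', _, hyY'⟩ := (IsWeaklyContinuous.toRepresentation hcont
    Y).exists_finiteDimensional_subrepresentation y
  let ι := subrepresentationSubtype X'
  let κ := subrepresentationSubtype Y'
  let j := (subrepresentationSubtype X).comp ι
  let k := (subrepresentationSubtype Y).comp κ
  have hj : Function.Injective j.toLinearMap := Subtype.val_injective.comp Subtype.val_injective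
  have hk : Function.Injective k.toLinearMap := Subtype.val_injective.comp Subtype.val_injective
  let β (n : ℤ) : (X'.toRepresentation.tprod Y'.toRepresentation).IntertwiningMap (rep act) :=
    (modeTensorIntertwining act n).comp (j.tensor k)
  let z : X'.toSubmodule ⊗[ℂ] Y'.toSubmodule := ⟨x, hxX'⟩ ⊗ₜ ⟨y, hyY'⟩
  refine intertwiningMap_mem_of_forall_mem hA hcont hU hGU (φ.comp (ι.tensor κ)) (β := β)
    (fun t ht => ?_) (z := z) fun n => hU.mode_mem _ hx n _ hy
  refine TensorProduct.map_injective_of_flat_flat _ _ hj hk ?_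
  rw [map_zero]
  exact hA.eq_zero_of_forall_modeTensor_eq_zero ht

end Intertwiners

section Decomposition

variable {V : Type*} [AddCommGroup V] [Module ℂ V] {A : VOA V} {G : Type*} [Group G]
  {act : G →* A.aut} {Λ : Type*} {W : Λ → Subrepresentation (rep act)}

theorem evalSum_lof_tmul [inst : DecidableEq Λ] (R : ∀ l, Submodule ℂ (W l).toSubmodule) (l : Λ)
    (w : R l) (f : MultSpace act W l) :
    evalSum act W R (DirectSum.lof ℂ Λ _ l (w ⊗ₜ f)) = f w := by
  obtain rfl : inst = fun _ _ => Classical.propDecidable _ := Subsingleton.elim _ _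
  classical exact DirectSum.toModule_lof ℂ l _

theorem evalSum_eq_isotypicEval_comp (R : ∀ l, Submodule ℂ (W l).toSubmodule) :
    evalSum act W R = isotypicEval (fun l => (W l).toRepresentation) (rep act) ∘ₗ
      DirectSum.lmap fun l => (R l).subtype.rTensor (MultSpace act W l) := by
  classical
  refine DirectSum.linearMap_ext ℂ fun l => TensorProduct.ext' fun w f => ?_
  simp only [LinearMap.comp_apply, evalSum_lof_tmul, DirectSum.lmap_lof, LinearMap.rTensor_tmul,
    isotypicEval_lof_tmul]
  rfl

theorem IsSystemOfSimples.finiteDimensional (hW : IsSystemOfSimples act W) (l : Λ) :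
    FiniteDimensional ℂ (W l).toSubmodule := by
  obtain ⟨k, hk⟩ := hW.homogeneous l
  have := A.gr_finite k
  exact Submodule.finiteDimensional_of_le hk

theorem IsSystemOfSimples.isotypicEval_injective (hW : IsSystemOfSimples act W) :
    Function.Injective (isotypicEval (fun l => (W l).toRepresentation) (rep act)) := by
  have := hW.finiteDimensional
  have := hW.irreducible
  exact _root_.isotypicEval_injective _ _ hW.inequivalent

theorem IsSystemOfSimples.isotypicEval_mem_range_evalSum_iff (hW : IsSystemOfSimples act W)
    (R : ∀ l, Submodule ℂ (W l).toSubmodule) (z : ⨁ l, (W l).toSubmodule ⊗[ℂ] MultSpace act W l) :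
    isotypicEval (fun l => (W l).toRepresentation) (rep act) z ∈ LinearMap.range (evalSum act W R) ↔
      ∀ l (α : Module.Dual ℂ (MultSpace act W l)),
        TensorProduct.rid ℂ _ (α.lTensor _ (z l)) ∈ R l := by
  rw [evalSum_eq_isotypicEval_comp, LinearMap.range_comp, Submodule.mem_map]
  simp only [hW.isotypicEval_injective.eq_iff, exists_eq_right, DirectSum.range_lmap,
    Submodule.mem_comap, Submodule.mem_pi, Set.mem_univ, true_imp_iff,
    ← mem_range_rTensor_subtype_iff_forall_dual]
  rfl

theorem IsSystemOfSimples.evalSum_injective (hW : IsSystemOfSimples act W)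
    (R : ∀ l, Submodule ℂ (W l).toSubmodule) : Function.Injective (evalSum act W R) := by
  rw [evalSum_eq_isotypicEval_comp]
  exact hW.isotypicEval_injective.comp <| (DirectSum.lmap_injective _).2 fun l =>
    Module.Flat.rTensor_preserves_injective_linearMap _ (R l).subtype_injective

variable {U : Submodule ℂ V}

theorem IsDecomposition.coeLinearMap_mem_iff [DecidableEq Λ]
    {R : ∀ l, Submodule ℂ (W l).toSubmodule}
    (hW : IsSystemOfSimples act W) (hR : IsDecomposition act W U R)
    (y : ⨁ l, (W l).toSubmodule) :
    DirectSum.coeLinearMap (fun l => (W l).toSubmodule) y ∈ U ↔ ∀ l, y l ∈ R l := by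
  let incl (l : Λ) : MultSpace act W l := subrepresentationSubtype (W l)
  let z := DirectSum.lmap (fun l => (TensorProduct.mk ℂ _ (MultSpace act W l)).flip (incl l)) y
  have hz : isotypicEval (fun l => (W l).toRepresentation) (rep act) z =
      DirectSum.coeLinearMap (fun l => (W l).toSubmodule) y := by
    have h : isotypicEval (fun l => (W l).toRepresentation) (rep act) ∘ₗ
        DirectSum.lmap (fun l => (TensorProduct.mk ℂ _ (MultSpace act W l)).flip (incl l)) =
          DirectSum.coeLinearMap fun l => (W l).toSubmodule :=
      DirectSum.linearMap_ext ℂ fun l => LinearMap.ext fun w => by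
        simp only [LinearMap.comp_apply, DirectSum.lmap_lof, LinearMap.flip_apply,
          TensorProduct.mk_apply, isotypicEval_lof_tmul, DirectSum.coeLinearMap_lof]
        rfl
    exact LinearMap.congr_fun h y
  rw [← hz, ← hR.2, hW.isotypicEval_mem_range_evalSum_iff]
  have hincl (l : Λ) : incl l ≠ 0 := fun h => by
    have := hW.irreducible l
    have : Nontrivial (W l).toSubmodule :=
      IsSimpleModule.nontrivial ℂ[G] (W l).toRepresentation.asModule
    obtain ⟨w, hw⟩ := exists_ne (0 : (W l).toSubmodule)
    exact hw (Subtype.ext congr($h w))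
  refine forall_congr' fun l => ⟨fun h => ?_, fun h α => ?_⟩
  · obtain ⟨α, hα⟩ := Module.Projective.exists_dual_ne_zero ℂ (hincl l)
    exact ((R l).smul_mem_iff hα).1 (h α)
  · exact (R l).smul_mem (α (incl l)) h

theorem IsDecomposition.eq_submoduleOf {R : ∀ l, Submodule ℂ (W l).toSubmodule}
    (hW : IsSystemOfSimples act W) (hR : IsDecomposition act W U R) :
    R = fun l => U.submoduleOf (W l).toSubmodule := by
  classical
  refine funext fun l => Submodule.ext fun y => ?_
  have hy := hR.coeLinearMap_mem_iff hW (DirectSum.lof ℂ Λ (fun l => (W l).toSubmodule) l y)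
  rw [DirectSum.coeLinearMap_lof] at hy
  refine Iff.trans ⟨fun h m => ?_, fun h => ?_⟩ hy.symm
  · obtain rfl | hml := eq_or_ne m l
    · rwa [DirectSum.lof_apply]
    · rw [DirectSum.lof_eq_of, DirectSum.of_eq_of_ne _ _ _ hml]
      exact zero_mem _
  · simpa only [DirectSum.lof_apply] using h l

theorem IsDecomposition.mem_totalSub_iff {R : ∀ l, Submodule ℂ (W l).toSubmodule}
    (hW : IsSystemOfSimples act W) (hR : IsDecomposition act W U R)
    {w : (total act W).toSubmodule} : w ∈ totalSub act W R ↔ (w : V) ∈ U := by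
  classical
  constructor
  · suffices h : totalSub act W R ≤ U.submoduleOf (total act W).toSubmodule from fun hw => h hw
    obtain rfl := hR.eq_submoduleOf hW
    exact iSup_le fun l => Submodule.map_le_iff_le_comap.2 le_rfl
  · intro hw
    have hwV : (w : V) ∈ LinearMap.range (DirectSum.coeLinearMap fun l => (W l).toSubmodule) := by
      rw [DirectSum.range_coeLinearMap]
      exact w.2
    obtain ⟨y, hy⟩ := hwV
    rw [← hy, hR.coeLinearMap_mem_iff hW] at hw
    let incl (l : Λ) := Submodule.inclusion (le_iSup (fun l => (W l).toSubmodule) l)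
    have hsum : w = ∑ l ∈ y.support, incl l (y l) := Subtype.ext <| by
      rw [← hy, DirectSum.coeLinearMap_eq_dfinsuppSum, DFinsupp.sum,
        AddSubmonoidClass.coe_finsetSum]
      rfl
    rw [hsum]
    exact sum_mem fun l _ => Submodule.mem_iSup_of_mem l (Submodule.mem_map_of_mem (hw l))

variable [TopologicalSpace G] [IsTopologicalGroup G] [CompactSpace G]
  (hA : A.IsSimple) (hcont : ActsContinuously act) (hU : A.IsSubVOA U)
  (hGU : (rep act).invariants ≤ U)
include hA hcont hU hGU

theorem range_evalSum_submoduleOf_le :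
    LinearMap.range (evalSum act W fun l => U.submoduleOf (W l).toSubmodule) ≤ U := by
  classical
  rintro _ ⟨z, rfl⟩
  induction z using DirectSum.induction_on with
  | zero => simp only [map_zero, zero_mem]
  | of l t =>
    induction t with
    | zero => simp only [map_zero, zero_mem]
    | tmul w f =>
      rw [← DirectSum.lof_eq_of ℂ, evalSum_lof_tmul]
      exact intertwiningMap_mem_of_mem hA hcont hU hGU f w.2
    | add s t hs ht => simpa only [map_add] using add_mem hs ht
  | add s t hs ht => simpa only [map_add] using add_mem hs ht

theorem isDecomposition_submoduleOf (hW : IsSystemOfSimples act W) :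
    IsDecomposition act W U fun l => U.submoduleOf (W l).toSubmodule := by
  refine ⟨hW.evalSum_injective _,
    (range_evalSum_submoduleOf_le hA hcont hU hGU).antisymm fun u hu => ?_⟩
  have hsurj := IsWeaklyContinuous.isotypicEval_surjective hcont hW.complete
  obtain ⟨z, rfl⟩ := hsurj u
  refine (hW.isotypicEval_mem_range_evalSum_iff _ z).2 fun l α => ?_
  obtain ⟨φ, hφ⟩ :=
    exists_intertwiningMap_isotypicEval_eq ⟨hW.isotypicEval_injective, hsurj⟩ l α
  rw [← hφ]
  exact intertwiningMap_mem_of_mem hA hcont hU hGU (X := ⊤)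
    ((subrepresentationSubtype (W l)).comp (φ.comp (subrepresentationSubtype ⊤)))
    (x := ⟨_, trivial⟩) hu

theorem IsDecomposition.map_range_totalSub_le {R : ∀ l, Submodule ℂ (W l).toSubmodule}
    (hW : IsSystemOfSimples act W) (hR : IsDecomposition act W U R)
    (π : ((total act W).toRepresentation.tprod (total act W).toRepresentation).IntertwiningMap
      (total act W).toRepresentation) :
    (LinearMap.range (TensorProduct.map (totalSub act W R).subtype
      (totalSub act W R).subtype)).map π.toLinearMap ≤ totalSub act W R := by
  rintro _ ⟨_, ⟨t, rfl⟩, rfl⟩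
  induction t with
  | zero => simp only [map_zero, zero_mem]
  | tmul x y =>
    exact (hR.mem_totalSub_iff hW).2 <|
      intertwiningMap_tmul_mem_of_mem hA hcont hU hGU
        ((subrepresentationSubtype (total act W)).comp π)
        ((hR.mem_totalSub_iff hW).1 x.2) ((hR.mem_totalSub_iff hW).1 y.2)
  | add s t hs ht => simpa only [map_add] using add_mem hs ht

end Decomposition

end VOA

theorem proposition2p1_general {V : Type*} [AddCommGroup V] [Module ℂ V] (A : VOA V)
    (hA : A.IsSimple)
    {G : Type*} [Group G] [TopologicalSpace G] [IsTopologicalGroup G] [CompactSpace G]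
    (act : G →* A.aut) (hcont : VOA.ActsContinuously act)
    {Λ : Type*} (W : Λ → Subrepresentation (VOA.rep act)) (hW : VOA.IsSystemOfSimples act W)
    (U : Submodule ℂ V) (hU : A.IsSubVOA U) (hGU : (VOA.rep act).invariants ≤ U) :
    (∃! R : ∀ l, Submodule ℂ (W l).toSubmodule, VOA.IsDecomposition act W U R) ∧
    ∀ R : ∀ l, Submodule ℂ (W l).toSubmodule, VOA.IsDecomposition act W U R →
      ∀ π : ((VOA.total act W).toRepresentation.tprod
          (VOA.total act W).toRepresentation).IntertwiningMap (VOA.total act W).toRepresentation,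
        (LinearMap.range (TensorProduct.map (VOA.totalSub act W R).subtype
          (VOA.totalSub act W R).subtype)).map π.toLinearMap ≤ VOA.totalSub act W R :=
  ⟨⟨_, VOA.isDecomposition_submoduleOf hA hcont hU hGU hW, fun _ hR => hR.eq_submoduleOf hW⟩,
    fun _ hR => hR.map_range_totalSub_le hA hcont hU hGU hW⟩

theorem proposition2p1 {V : Type*} [AddCommGroup V] [Module ℂ V] (A : VOA V) (hA : A.IsSimple)
    {E : Type*} [NormedAddCommGroup E] [NormedSpace ℝ E] [FiniteDimensional ℝ E]
    {G : Type*} [Group G] [TopologicalSpace G] [ChartedSpace E G] [LieGroup 𝓘(ℝ, E) ∞ G]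
    [CompactSpace G] [T2Space G]
    (act : G →* A.aut) (hact : Function.Injective act) (hcont : VOA.ActsContinuously act)
    {Λ : Type*} (W : Λ → Subrepresentation (VOA.rep act)) (hW : VOA.IsSystemOfSimples act W)
    (U : Submodule ℂ V) (hU : A.IsSubVOA U) (hGU : (VOA.rep act).invariants ≤ U) :
    (∃! R : ∀ l, Submodule ℂ (W l).toSubmodule, VOA.IsDecomposition act W U R) ∧
    ∀ R : ∀ l, Submodule ℂ (W l).toSubmodule, VOA.IsDecomposition act W U R →
      ∀ π : ((VOA.total act W).toRepresentation.tprod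
          (VOA.total act W).toRepresentation).IntertwiningMap (VOA.total act W).toRepresentation,
        (LinearMap.range (TensorProduct.map (VOA.totalSub act W R).subtype
          (VOA.totalSub act W R).subtype)).map π.toLinearMap ≤ VOA.totalSub act W R := by
  have := topologicalGroup_of_lieGroup 𝓘(ℝ, E) ∞ (G := G)
  exact proposition2p1_general A hA act hcont W hW U hU hGU
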